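/- Let $V$ be a finite-dimensional complex vector space and let $U\subset\mathbb C$ be a non-empty open connected set. A function $f:U\to V$ is called holomorphic if $w\circ f$ is holomorphic on $U$ for every linear form $w\in V^*$. For functions $f_1,\dots,f_k:U\to V$ define the rank of $\{f_1,\dots,f_k\}$ as $$\operatorname{rank}\{f_1,\dots,f_k\}=\max_{c\in U}\operatorname{rank}\{f_1(c),\dots,f_k(c)\},$$ where the rank of finitely many vectors is the dimension of their linear span, and call $\{f_1,\dots,f_k\}$ of constant rank if $\operatorname{rank}\{f_1(c),\dots,f_k(c)\}=\operatorname{rank}\{f_1,\dots,f_k\}$ for all $c\in U$. Proposition. Let $f_1,\dots,f_k$ be holomorphic $V$-valued functions on $U$ such that $\{f_1,\dots,f_k\}$ has rank $l$ (so $l\le k$). (1) There are holomorphic $V$-valued functions $g_1,\dots,g_l$ on $U$ such that $\{g_1,\dots,g_l\}$ is of constant rank $l$, and holomorphic functions $d^\beta_\alpha:U\to\mathbb C$ ($1\le\alpha\le k$, $1\le\beta\le l$), such that $$f_\alpha=\sum_{\beta=1}^{l}g_\beta\,d^\beta_\alpha\quad\text{on }U,\qquad \alpha=1,\dots,k.$$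 (2) Let $\{g_1,\dots,g_l\}$ and $\{g'_1,\dots,g'_l\}$ be any two sets of holomorphic $V$-valued functions on $U$ of constant rank $l$ such that, for some holomorphic functions $d^\beta_\alpha$ and $d'^\beta_\alpha$ on $U$, $$f_\alpha=\sum_{\beta=1}^{l}g_\beta\,d^\beta_\alpha=\sum_{\beta=1}^{l}g'_\beta\,d'^\beta_\alpha\quad\text{on }U,\qquad \alpha=1,\dots,k.$$ Then there are holomorphic functions $c^\beta_\alpha:U\to\mathbb C$ ($1\le\alpha,\beta\le l$) such that $$g'_\alpha=\sum_{\beta=1}^{l}g_\beta\,c^\beta_\alpha\quad\text{on }U,\qquad \alpha=1,\dots,l.$$ -/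

import Mathlib

namespace VectorValued

variable {V : Type*} [AddCommGroup V] [Module ℂ V]

/-- A `V`-valued function `f` is holomorphic on `U` if for every linear form `w` on `V`
the complex function `w (f)` is holomorphic on `U`. (Only the values of `f` on `U` matter.) -/
def IsHolomorphicOn (f : ℂ → V) (U : Set ℂ) : Prop :=
  ∀ w : Module.Dual ℂ V, DifferentiableOn ℂ (fun z => w (f z)) U

/-- The rank of the vectors `f₁(c), …, f_k(c)`: the dimension of their linear span. -/
noncomputable def rankAt {k : ℕ} (f : Fin k → ℂ → V) (c : ℂ) : ℕ :=
  Module.finrank ℂ (Submodule.span ℂ (Set.range fun α => f α c))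

/-- The rank on `U` of a finite family of `V`-valued functions: the largest value on `U` of the
pointwise rank. (The pointwise rank is at most `k`, so the supremum is a maximum if `U ≠ ∅`.) -/
noncomputable def rankOn {k : ℕ} (f : Fin k → ℂ → V) (U : Set ℂ) : ℕ :=
  ⨆ c : U, rankAt f c

/-- A finite family of `V`-valued functions is of constant rank on `U` if its pointwise rank at
every point of `U` equals its rank on `U`. -/
def IsConstantRankOn {k : ℕ} (f : Fin k → ℂ → V) (U : Set ℂ) : Prop :=
  ∀ c ∈ U, rankAt f c = rankOn f U

/-- `g₁, …, g_l` is a set of holomorphic `V`-valued functions on `U` of constant rank `l`, where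
`l` is the number of functions in the family. -/
def IsHolomorphicFrameOn {l : ℕ} (g : Fin l → ℂ → V) (U : Set ℂ) : Prop :=
  (∀ β, IsHolomorphicOn (g β) U) ∧ IsConstantRankOn g U ∧ rankOn g U = l

/-- `f_α = ∑_β g_β d^β_α` on `U`, for every `α`, with all the complex functions `d^β_α`
holomorphic on `U`. Here `d β α` stands for `d^β_α`. -/
def IsHolomorphicRepOn {k l : ℕ} (f : Fin k → ℂ → V) (g : Fin l → ℂ → V)
    (d : Fin l → Fin k → ℂ → ℂ) (U : Set ℂ) : Prop :=
  (∀ β α, DifferentiableOn ℂ (d β α) U) ∧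
    ∀ α, ∀ z ∈ U, f α z = ∑ β, d β α z • g β z

end VectorValued

/-! The holomorphic functions on a connected open `U` form a Bézout ring in a strong sense: any two
have a common divisor `d` with cofactors that generate the unit ideal (`exists_bezout`). The divisor
comes from Weierstrass' theorem, with order at each point the smaller of the two orders. The Bézout
relation between the cofactors comes from the theorem of Mittag-Leffler.

Over such a ring a matrix is brought to triangular form by an invertible matrix
(`exists_linearEquiv_triangular`). Applied to the coordinates of `l` sections of `U × V`, this gives
a holomorphic trivialization in which they have only their first `l` coordinates
(`exists_adapted_trivialization`).

For (1), take `l` of the `f_α` that are independent near a point where the rank is attained. All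
`f_α` lie in their span near that point, so by the identity theorem their coordinates beyond the
first `l` vanish on all of `U`. The first `l` vectors of the trivializing frame are the `g_β`.

For (2), near such a point `g` and `g'` both span the span of `f`. In a trivialization adapted to
`g`, the identity theorem confines `g'` to the first `l` coordinates everywhere, and Cramer's rule
gives holomorphic coefficients. -/

open Filter Topology Set

/-! ### Locally finite sets, approximation and gluing -/

/-- `A` has no accumulation point in `U`. -/
def LocallyFiniteIn (A U : Set ℂ) : Prop :=
  ∀ c ∈ U, ∃ t ∈ 𝓝 c, (A ∩ t).Finite

namespace LocallyFiniteIn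

variable {A U K : Set ℂ}

theorem finite_inter (hA : LocallyFiniteIn A U) (hK : IsCompact K) (hKU : K ⊆ U) :
    (A ∩ K).Finite := by
  refine hK.induction_on (p := fun s => (A ∩ s).Finite) (by simp)
    (fun s t hst ht => ht.subset (inter_subset_inter_right _ hst))
    (fun s t hs ht => by rw [inter_union_distrib_left]; exact hs.union ht) ?_
  intro x hx
  obtain ⟨t, ht, hf⟩ := hA x (hKU hx)
  exact ⟨t, mem_nhdsWithin_of_mem_nhds ht, hf⟩

theorem countable (hA : LocallyFiniteIn A U) (hAU : A ⊆ U) : A.Countable := by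
  choose! t ht hf using hA
  obtain ⟨s, hsU, hs, hcov⟩ := TopologicalSpace.countable_cover_nhdsWithin (f := t) (s := U)
    fun x hx => mem_nhdsWithin_of_mem_nhds (ht x hx)
  have : A ⊆ ⋃ x ∈ s, A ∩ t x := fun a ha => by
    have := hcov (hAU ha)
    simp only [mem_iUnion, mem_inter_iff, exists_prop] at this ⊢
    obtain ⟨x, hx, hax⟩ := this
    exact ⟨x, hx, ha, hax⟩
  exact (hs.biUnion fun x hx => (hf x (hsU hx)).countable).mono this

end LocallyFiniteIn

/-- Around the points of a locally finite set there are coordinates `1 - w`, with values that are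
far from zero on compact sets: `w a z = 1 - (z - a) * v a z` is at most `1 / 2` on any compact
set, for all but finitely many `a`. -/
theorem exists_localizing_coordinates {A U : Set ℂ} (hU : IsOpen U)
    (hA : LocallyFiniteIn A U) :
    ∃ v : ℂ → ℂ → ℂ, (∀ a ∈ A, DifferentiableOn ℂ (v a) U ∧ ∀ z ∈ U, v a z ≠ 0) ∧
      ∀ K ⊆ U, IsCompact K →
        {a | a ∈ A ∧ ∃ z ∈ K, 1 / 2 < ‖1 - (z - a) * v a z‖}.Finite := by
  classical
  have hb : ∀ a : ℂ, ∃ b, (Uᶜ).Nonempty → b ∈ Uᶜ ∧ Metric.infDist a Uᶜ = ‖a - b‖ := by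
    intro a
    by_cases h : (Uᶜ).Nonempty
    · obtain ⟨b, hb, hd⟩ := hU.isClosed_compl.exists_infDist_eq_dist h a
      exact ⟨b, fun _ => ⟨hb, by rw [hd, dist_eq_norm]⟩⟩
    · exact ⟨0, fun h' => absurd h' h⟩
  choose b hb using hb
  -- `p a` selects the points treated as close to the complement of `U`, for which `w = (a - b) / (z
  -- - b)` with `b` a nearest point of the complement. The others are treated as close to infinity,
  -- with `w = z / a`. The value `-1` at `a = 0` only keeps `v` free of zeros.
  set p : ℂ → Prop := fun a => (Uᶜ).Nonempty ∧ ‖a‖ * ‖a - b a‖ < 1 with hp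
  refine ⟨fun a z => if p a then 1 / (z - b a) else if a = 0 then -1 else -1 / a, ?_, ?_⟩
  · intro a ha
    by_cases h : p a
    · have hne : ∀ z ∈ U, z - b a ≠ 0 := fun z hz h0 => by
        rw [sub_eq_zero] at h0
        exact (hb a h.1).1 (h0 ▸ hz)
      simp only [h, if_true]
      refine ⟨?_, fun z hz => one_div_ne_zero (hne z hz)⟩
      exact DifferentiableOn.div (by fun_prop) (by fun_prop) hne
    · by_cases h0 : a = 0
      · simp only [h, if_false]
        simp [h0]
      · simp only [h, h0, if_false]
        refine ⟨by fun_prop, fun z hz => by simp [h0]⟩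
  · intro K hKU hK
    obtain ⟨R, hR0, hR⟩ : ∃ R : ℝ, 0 < R ∧ ∀ z ∈ K, ‖z‖ ≤ R := by
      obtain ⟨R, hR⟩ := hK.isBounded.exists_norm_le
      exact ⟨max R 1, by positivity, fun z hz => (hR z hz).trans (le_max_left _ _)⟩
    obtain ⟨δ, hδ0, hδ⟩ : ∃ δ : ℝ, 0 < δ ∧ ∀ z ∈ K, ∀ y ∈ Uᶜ, δ ≤ ‖z - y‖ := by
      rcases (Uᶜ).eq_empty_or_nonempty with h | h
      · exact ⟨1, one_pos, by simp [h]⟩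
      obtain ⟨δ, hδ, hd⟩ := hK.exists_thickening_subset_open hU hKU
      refine ⟨δ, hδ, fun z hz y hy => ?_⟩
      by_contra! hlt
      refine hy (hd ?_)
      rw [Metric.mem_thickening_iff]
      exact ⟨z, hz, by rwa [dist_comm, dist_eq_norm]⟩
    -- `ε` and `T` are such that a point `a` outside `L` has `‖a - b a‖ ≤ δ / 2` if `p a`, and `‖a‖
    -- > 2 * R` otherwise. As `‖z - b a‖ ≥ δ` and `‖z‖ ≤ R` on `K`, both quotients are then at most
    -- `1 / 2`.
    set ε : ℝ := min (δ / 2) (1 / (2 * R)) with hε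
    have hε0 : 0 < ε := by positivity
    set T : ℝ := max (2 * R) (2 / δ) with hT
    set L : Set ℂ := Metric.closedBall 0 T ∩ {z | (Uᶜ).Nonempty → ε ≤ Metric.infDist z Uᶜ} with hL
    have hLc : IsCompact L := by
      refine (isCompact_closedBall _ _).inter_right ?_
      by_cases h : (Uᶜ).Nonempty
      · simp only [h, true_imp_iff]
        exact isClosed_le continuous_const (Metric.continuous_infDist_pt _)
      · simp [h]
    have hLU : L ⊆ U := by
      intro z hz
      by_contra hzU
      have := hz.2 ⟨z, hzU⟩
      rw [Metric.infDist_zero_of_mem (show z ∈ Uᶜ from hzU)] at this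
      linarith
    refine (hA.finite_inter hLc hLU).subset ?_
    rintro a ⟨ha, z, hz, hlt⟩
    refine ⟨ha, ?_⟩
    by_contra haL
    refine absurd hlt (not_lt.2 ?_)
    have hzR := hR z hz
    by_cases h : p a
    · simp only [h, if_true]
      have hbz := hδ z hz _ (hb a h.1).1
      have hne : z - b a ≠ 0 := fun h0 => by rw [h0, norm_zero] at hbz; linarith
      have : 1 - (z - a) * (1 / (z - b a)) = (a - b a) / (z - b a) := by
        field_simp; ring
      rw [this, norm_div, div_le_iff₀ (by linarith)]
      have hab : ‖a - b a‖ ≤ δ / 2 := by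
        by_contra! hgt
        refine haL ⟨?_, fun _ => ?_⟩
        · rw [mem_closedBall_zero_iff]
          refine le_trans ?_ (le_max_right _ _)
          have h2 := h.2
          rw [le_div_iff₀ hδ0]
          nlinarith [norm_nonneg a]
        · show ε ≤ Metric.infDist a Uᶜ
          rw [(hb a h.1).2]
          exact (min_le_left _ _).trans hgt.le
      linarith
    · have haT : 2 * R < ‖a‖ := by
        by_contra! hle
        refine haL ⟨?_, fun hne => ?_⟩
        · rw [mem_closedBall_zero_iff]
          exact hle.trans (le_max_left _ _)
        · show ε ≤ Metric.infDist a Uᶜ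
          rw [(hb a hne).2]
          refine (min_le_right _ _).trans ?_
          have : 1 ≤ ‖a‖ * ‖a - b a‖ := by
            by_contra! h1
            exact h ⟨hne, h1⟩
          rw [div_le_iff₀ (by positivity)]
          nlinarith [norm_nonneg (a - b a)]
      have h0 : a ≠ 0 := by
        rintro rfl
        rw [norm_zero] at haT
        linarith
      simp only [h, h0, if_false]
      have : 1 - (z - a) * (-1 / a) = z / a := by field_simp; ring
      rw [this, norm_div, div_le_iff₀ (by linarith)]
      linarith

/-- A holomorphic function on the unit disc is uniformly approximated by entire functions on the
disc of radius `1 / 2`. -/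
theorem exists_entire_approx {φ : ℂ → ℂ} (hφ : DifferentiableOn ℂ φ (Metric.ball 0 1)) {ε : ℝ}
    (hε : 0 < ε) :
    ∃ q : ℂ → ℂ, Differentiable ℂ q ∧ ∀ z, ‖z‖ ≤ 1 / 2 → ‖φ z - q z‖ ≤ ε := by
  -- The approximants are Taylor polynomials at `0`; the radii only need `1/2 < 5/8 < 3/4 < 1`.
  have h := (hφ.mono (Metric.closedBall_subset_ball (show ((3 / 4 : NNReal) : ℝ) < 1 by
    norm_num))).hasFPowerSeriesOnBall (by norm_num)
  have h' := h.tendstoUniformlyOn (r' := 5 / 8) (by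
    rw [ENNReal.coe_lt_coe, div_lt_div_iff₀ (by norm_num) (by norm_num)]; norm_num)
  rw [Metric.tendstoUniformlyOn_iff] at h'
  obtain ⟨n, hn⟩ := (h' ε hε).exists
  refine ⟨fun z => (cauchyPowerSeries φ 0 ((3 / 4 : NNReal) : ℝ)).partialSum n z, ?_, ?_⟩
  · simp only [FormalMultilinearSeries.partialSum, FormalMultilinearSeries.apply_eq_pow_smul_coeff]
    fun_prop
  · intro z hz
    have := hn z (by
      rw [mem_ball_zero_iff]; refine hz.trans_lt ?_
      push_cast; norm_num)
    rw [dist_eq_norm, zero_add] at this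
    exact this.le

/-- Removable singularities for a family of local extensions. -/
theorem exists_differentiableOn_of_punctured {X : ℂ → ℂ} {U : Set ℂ} (hU : IsOpen U)
    (h : ∀ c ∈ U, ∃ r : ℂ → ℂ, AnalyticAt ℂ r c ∧ X =ᶠ[𝓝[≠] c] r) :
    ∃ Y : ℂ → ℂ, DifferentiableOn ℂ Y U ∧ ∀ c ∈ U, Y =ᶠ[𝓝[≠] c] X := by
  choose! r hr hX using h
  -- The glued function takes at `z` the value of the extension chosen for `z`. At `z ≠ c` near `c`,
  -- both `r z` and `r c` agree with `X` on a punctured neighbourhood of `z`, hence at `z` by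
  -- continuity.
  have key : ∀ c ∈ U, (fun z => r z z) =ᶠ[𝓝 c] r c := by
    intro c hc
    have h1 : ∀ᶠ z in 𝓝[≠] c, r z z = r c z := by
      have h2 : ∀ᶠ z in 𝓝[≠] c, ∀ᶠ y in 𝓝 z, X y = r c y := by
        have := eventually_eventually_nhdsWithin.2 (hX c hc)
        filter_upwards [this, self_mem_nhdsWithin] with z hz hzc
        rwa [(isOpen_compl_singleton (x := c)).nhdsWithin_eq hzc] at hz
      filter_upwards [h2, nhdsWithin_le_nhds (hr c hc).eventually_analyticAt,
        nhdsWithin_le_nhds (hU.mem_nhds hc)] with z hz hza hzU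
      have : r z =ᶠ[𝓝 z] r c :=
        ((hr z hzU).continuousAt.eventuallyEq_nhds_iff_eventuallyEq_nhdsNE
          hza.continuousAt).1 ((hX z hzU).symm.trans (hz.filter_mono nhdsWithin_le_nhds))
      exact this.eq_of_nhds
    rw [eventually_nhdsWithin_iff] at h1
    filter_upwards [h1] with z hz
    by_cases hzc : z = c
    · rw [hzc]
    · exact hz hzc
  refine ⟨fun z => r z z, fun c hc => ?_, fun c hc => ?_⟩
  · exact (((hr c hc).differentiableAt).congr_of_eventuallyEq (key c hc)).differentiableWithinAt
  · exact ((key c hc).filter_mono nhdsWithin_le_nhds).trans (hX c hc).symm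

/-- The Weierstrass M-test, with the finitely many terms in `S` set to zero: these are the ones that
may be large or singular, and they are treated separately. -/
theorem exists_differentiableOn_hasSum {ι : Type*} {t : ι → ℂ → ℂ} {B : Set ℂ} (hB : IsOpen B)
    {ε : ι → ℝ} (hε0 : ∀ i, 0 ≤ ε i) (hε : Summable ε) (S : Finset ι) [DecidableEq ι]
    (ht : ∀ i ∉ S, DifferentiableOn ℂ (t i) B ∧ ∀ z ∈ B, ‖t i z‖ ≤ ε i) :
    ∃ T : ℂ → ℂ, DifferentiableOn ℂ T B ∧
      ∀ z ∈ B, HasSum (fun i => if i ∈ S then 0 else t i z) (T z) := by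
  have hb : ∀ i, ∀ z ∈ B, ‖if i ∈ S then 0 else t i z‖ ≤ ε i := by
    intro i z hz
    split_ifs with h
    · simpa using hε0 i
    · exact (ht i h).2 z hz
  refine ⟨fun z => ∑' i, if i ∈ S then 0 else t i z, ?_, fun z hz => ?_⟩
  · refine Complex.differentiableOn_tsum_of_summable_norm hε (fun i => ?_) hB
      fun i z hz => hb i z hz
    split_ifs with h
    · exact differentiableOn_const _
    · exact (ht i h).1
  · exact (Summable.of_norm_bounded hε fun i => hb i z hz).hasSum

/-- Near a point of `U` all but finitely many of the localizing coordinates are small. -/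
theorem exists_ball_finset {A U : Set ℂ} (hU : IsOpen U) {v : ℂ → ℂ → ℂ}
    (hv : ∀ K ⊆ U, IsCompact K →
      {a | a ∈ A ∧ ∃ z ∈ K, 1 / 2 < ‖1 - (z - a) * v a z‖}.Finite) {c : ℂ} (hc : c ∈ U) :
    ∃ B ⊆ U, IsOpen B ∧ c ∈ B ∧ ∃ S : Finset A, (∀ h : c ∈ A, ⟨c, h⟩ ∈ S) ∧
      ∀ a ∉ S, ∀ z ∈ B, ‖1 - (z - a) * v a z‖ ≤ 1 / 2 := by
  obtain ⟨r, hr, hrU⟩ := Metric.nhds_basis_closedBall.mem_iff.1 (hU.mem_nhds hc)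
  have hf := hv _ hrU (isCompact_closedBall c r)
  have hf' := hf.preimage (Subtype.val_injective.injOn (s := (Subtype.val : A → ℂ) ⁻¹' _))
  refine ⟨Metric.ball c r, Metric.ball_subset_closedBall.trans hrU, Metric.isOpen_ball,
    Metric.mem_ball_self hr, hf'.toFinset, fun h => ?_, fun a ha z hz => ?_⟩
  · rw [Finite.mem_toFinset]
    exact ⟨h, c, Metric.mem_closedBall_self hr.le, by norm_num⟩
  · by_contra! hlt
    refine ha ?_
    rw [Finite.mem_toFinset]
    exact ⟨a.2, z, Metric.ball_subset_closedBall hz, hlt⟩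

/-! ### The theorems of Weierstrass and Mittag-Leffler -/

/-- Weierstrass' theorem: prescribed zeros of a holomorphic function on an open set. -/
theorem exists_prescribed_zeros {U : Set ℂ} (hU : IsOpen U) (m : ℂ → ℕ)
    (hm : LocallyFiniteIn {c | c ∈ U ∧ m c ≠ 0} U) :
    ∃ D : ℂ → ℂ, ∀ c ∈ U, ∃ e : ℂ → ℂ, AnalyticAt ℂ e c ∧ e c ≠ 0 ∧
      D =ᶠ[𝓝 c] fun z => (z - c) ^ m c * e z := by
  classical
  set A := {c | c ∈ U ∧ m c ≠ 0} with hA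
  have hAU : A ⊆ U := fun c hc => hc.1
  obtain ⟨v, hv, hvK⟩ := exists_localizing_coordinates hU hm
  obtain ⟨ε, hε0, s, hεs, -⟩ := (hm.countable hAU).exists_pos_hasSum_le one_pos
  -- The convergence factors: since `(z - a) * v a z = 1 - w`, the factor `F a` is the exponential
  -- of `m a * log (1 - w) - q a w`, which is at most `ε a` in norm wherever `‖w‖ ≤ 1 / 2`.
  have hq : ∀ a, ∃ q : ℂ → ℂ, Differentiable ℂ q ∧
      ∀ z, ‖z‖ ≤ 1 / 2 → ‖m a * Complex.log (1 - z) - q z‖ ≤ ε a := by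
    intro a
    refine exists_entire_approx (DifferentiableOn.const_mul ?_ _) (hε0 a)
    refine DifferentiableOn.clog (by fun_prop) fun z hz => ?_
    refine Or.inl ?_
    rw [mem_ball_zero_iff] at hz
    have := (Complex.re_le_norm z).trans_lt hz
    simp only [Complex.sub_re, Complex.one_re]
    linarith
  choose q hqd hq using hq
  set w : ℂ → ℂ → ℂ := fun a z => 1 - (z - a) * v a z with hw
  set F : A → ℂ → ℂ := fun a z => ((z - a) * v a z) ^ m a * Complex.exp (- q a (w a z)) with hF
  have hwd : ∀ a ∈ A, DifferentiableOn ℂ (w a) U := fun a ha => by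
    have := (hv a ha).1
    fun_prop
  have hFa : ∀ a : A, ∀ c ∈ U, AnalyticAt ℂ (F a) c := fun a c hc => by
    have h1 := (hv a a.2).1
    have h2 := (hqd a).comp_differentiableOn (hwd a a.2)
    have : DifferentiableOn ℂ (F a) U := by
      refine DifferentiableOn.mul (by fun_prop) (DifferentiableOn.cexp ?_)
      exact h2.neg
    exact this.analyticAt (hU.mem_nhds hc)
  refine ⟨fun z => ∏' a, F a z, fun c hc => ?_⟩
  obtain ⟨B, hBU, hB, hcB, S, hcS, hS⟩ := exists_ball_finset hU hvK hc
  obtain ⟨T, hT, hTs⟩ := exists_differentiableOn_hasSum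
    (t := fun (a : A) z => m a * Complex.log (1 - w a z) - q a (w a z)) hB
    (fun a => (hε0 a).le) hεs.summable S (fun a ha => ⟨by
      have h1 := (hwd a a.2).mono hBU
      have h2 := (hqd a).comp_differentiableOn h1
      refine DifferentiableOn.sub (DifferentiableOn.const_mul (DifferentiableOn.clog (by fun_prop)
        fun z hz => Or.inl ?_) _) h2
      have := (Complex.re_le_norm (w a z)).trans (hS a ha z hz)
      simp only [Complex.sub_re, Complex.one_re]
      linarith, fun z hz => hq a _ (hS a ha z hz)⟩)
  have hprod : ∀ z ∈ B, ∏' a, F a z = (∏ a ∈ S, F a z) * Complex.exp (T z) := by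
    intro z hz
    have h1 : HasProd (fun a => if a ∈ S then F a z else 1) (∏ a ∈ S, F a z) := by
      have := hasProd_prod_of_ne_finset_one (f := fun a => if a ∈ S then F a z else 1) (s := S)
        (L := .unconditional _) (fun a ha => by simp [ha])
      rwa [Finset.prod_congr rfl fun a ha => if_pos ha] at this
    refine HasProd.tprod_eq ?_
    convert h1.mul (hTs z hz).cexp using 2 with a
    by_cases ha : a ∈ S
    · simp [ha]
    · have hlt := hS a ha z hz
      have hne : (z - a) * v a z ≠ 0 := by
        intro h0
        rw [h0] at hlt
        norm_num at hlt
      have : 1 - w a z = (z - a) * v a z := by simp [hw]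
      simp only [ha, if_false, one_mul, Function.comp, hF, this, Complex.exp_sub, Complex.exp_neg,
        Complex.exp_nat_mul, Complex.exp_log hne, div_eq_mul_inv]
  have hDeq : (fun z => ∏' a, F a z) =ᶠ[𝓝 c] fun z => (∏ a ∈ S, F a z) * Complex.exp (T z) :=
    Filter.eventually_of_mem (hB.mem_nhds hcB) hprod
  have hTa : AnalyticAt ℂ (fun z => Complex.exp (T z)) c :=
    (hT.analyticAt (hB.mem_nhds hcB)).cexp
  have hF0 : ∀ a : A, (a : ℂ) ≠ c → F a c ≠ 0 := fun a ha =>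
    mul_ne_zero (pow_ne_zero _ (mul_ne_zero (sub_ne_zero.2 ha.symm) ((hv a a.2).2 c hc)))
      (Complex.exp_ne_zero _)
  by_cases hcA : c ∈ A
  · refine ⟨fun z => (v c z ^ m c * Complex.exp (- q c (w c z))) *
      (∏ a ∈ S.erase ⟨c, hcA⟩, F a z) * Complex.exp (T z), ?_, ?_, ?_⟩
    · have h1 := (hv c hcA).1.analyticAt (hU.mem_nhds hc)
      have h2 := ((hqd c).comp_differentiableOn (hwd c hcA)).analyticAt (hU.mem_nhds hc)
      refine (((h1.pow _).mul h2.neg.cexp).mul ?_).mul hTa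
      exact Finset.analyticAt_fun_prod _ fun a _ => hFa a c hc
    · refine mul_ne_zero (mul_ne_zero (mul_ne_zero (pow_ne_zero _ ((hv c hcA).2 c hc))
        (Complex.exp_ne_zero _)) ?_) (Complex.exp_ne_zero _)
      refine Finset.prod_ne_zero_iff.2 fun a ha => hF0 a fun h => ?_
      exact (Finset.mem_erase.1 ha).1 (Subtype.ext h)
    · refine hDeq.trans (Eventually.of_forall fun z => ?_)
      simp only
      rw [← Finset.mul_prod_erase S _ (hcS hcA)]
      have : F ⟨c, hcA⟩ z = (z - c) ^ m c * (v c z ^ m c * Complex.exp (- q c (w c z))) := by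
        simp only [hF, mul_pow, mul_assoc]
      rw [this]
      ring
  · have hm0 : m c = 0 := by
      by_contra h
      exact hcA ⟨hc, h⟩
    refine ⟨fun z => (∏ a ∈ S, F a z) * Complex.exp (T z), ?_, ?_, ?_⟩
    · exact (Finset.analyticAt_fun_prod _ fun a _ => hFa a c hc).mul hTa
    · refine mul_ne_zero (Finset.prod_ne_zero_iff.2 fun a ha => hF0 a fun h => ?_)
        (Complex.exp_ne_zero _)
      exact hcA (h ▸ a.2)
    · simpa [hm0] using hDeq

/-- Taylor expansion of an analytic function in a local coordinate. -/
theorem exists_polynomial_jet {c : ℂ} {v : ℂ → ℂ} (hv : AnalyticAt ℂ v c) (hv0 : v c ≠ 0) (m : ℕ) :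
    ∀ {u : ℂ → ℂ}, AnalyticAt ℂ u c → ∃ (P : Polynomial ℂ) (r : ℂ → ℂ), AnalyticAt ℂ r c ∧
      ∀ᶠ z in 𝓝 c, u z = P.eval ((z - c) * v z) + ((z - c) * v z) ^ m * r z := by
  induction m with
  | zero => exact fun {u} hu => ⟨0, u, hu, by simp⟩
  | succ m ih =>
    intro u hu
    have h1 : AnalyticAt ℂ (fun z => u z - u c) c := hu.sub analyticAt_const
    have h2 : ((1 : ℕ) : ℕ∞) ≤ analyticOrderAt (fun z => u z - u c) c := by
      rw [Nat.cast_one, Order.one_le_iff_ne_zero, h1.analyticOrderAt_ne_zero]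
      simp
    obtain ⟨g, hg, hug⟩ := (natCast_le_analyticOrderAt h1).1 h2
    -- `u - u c = (z - c) * g = ((z - c) * v) * (g / v)`, so the induction continues with `g / v`.
    obtain ⟨P, r, hr, hP⟩ := ih (hg.div hv hv0)
    refine ⟨Polynomial.C (u c) + Polynomial.X * P, r, hr, ?_⟩
    filter_upwards [hug, hP, hv.continuousAt.eventually_ne hv0] with z h1 h2 h3
    simp only [Polynomial.eval_add, Polynomial.eval_mul, Polynomial.eval_C, Polynomial.eval_X]
    simp only [Pi.div_apply, pow_one, smul_eq_mul] at h1 h2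
    have h4 : g z = v z * (Polynomial.eval ((z - c) * v z) P + ((z - c) * v z) ^ m * r z) := by
      rw [← h2]; field_simp
    rw [h4] at h1
    linear_combination h1

/-- The theorem of Mittag-Leffler: prescribed principal parts on an open set. -/
theorem exists_prescribed_principal_parts {A U : Set ℂ} (hU : IsOpen U) (hAU : A ⊆ U)
    (hA : LocallyFiniteIn A U) {h : ℂ → ℂ → ℂ} (hh : ∀ c ∈ A, MeromorphicAt (h c) c) :
    ∃ M : ℂ → ℂ, ∀ c ∈ U, ∃ r : ℂ → ℂ, AnalyticAt ℂ r c ∧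
      (c ∈ A → M =ᶠ[𝓝[≠] c] fun z => h c z + r z) ∧ (c ∉ A → M =ᶠ[𝓝[≠] c] r) := by
  classical
  obtain ⟨v, hv, hvK⟩ := exists_localizing_coordinates hU hA
  obtain ⟨ε, hε0, s, hεs, -⟩ := (hA.countable hAU).exists_pos_hasSum_le one_pos
  set w : ℂ → ℂ → ℂ := fun a z => 1 - (z - a) * v a z with hw
  have hwd : ∀ a ∈ A, DifferentiableOn ℂ (w a) U := fun a ha => by
    have := (hv a ha).1
    fun_prop
  -- Up to a holomorphic term, the principal part at `a` is a function `φ` of `w` with its only pole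
  -- at `w = 1`. It is therefore close to an entire function of `w` where `‖w‖ ≤ 1 / 2`, which is
  -- subtracted to make the series converge.
  have hφ : ∀ a, ∃ φ : ℂ → ℂ, DifferentiableOn ℂ φ {1}ᶜ ∧ (a ∈ A → ∃ r : ℂ → ℂ, AnalyticAt ℂ r a ∧
      ∀ᶠ z in 𝓝[≠] a, φ (w a z) = h a z + r z) := by
    intro a
    by_cases ha : a ∈ A
    swap
    · exact ⟨0, differentiableOn_const _, fun h => absurd h ha⟩
    obtain ⟨m, hm⟩ := hh a ha
    have hva := (hv a ha).1.analyticAt (hU.mem_nhds (hAU ha))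
    have hv0 := (hv a ha).2 a (hAU ha)
    obtain ⟨P, r, hr, hP⟩ := exists_polynomial_jet hva hv0 m ((hva.pow m).mul hm)
    refine ⟨fun z => P.eval (1 - z) / (1 - z) ^ m, ?_, fun _ => ⟨-r, hr.neg, ?_⟩⟩
    · refine DifferentiableOn.div ?_ (by fun_prop) fun z hz => pow_ne_zero _
        (sub_ne_zero.2 fun h => hz h.symm)
      exact (P.differentiable.comp (by fun_prop)).differentiableOn
    · filter_upwards [nhdsWithin_le_nhds hP, self_mem_nhdsWithin,
        nhdsWithin_le_nhds (hva.continuousAt.eventually_ne hv0)] with z hz hza hvz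
      have hza' : z - a ≠ 0 := sub_ne_zero.2 hza
      simp only [Pi.mul_apply, Pi.pow_apply, smul_eq_mul] at hz
      simp only [hw, sub_sub_cancel, Pi.neg_apply]
      rw [div_eq_iff (pow_ne_zero _ (mul_ne_zero hza' hvz)), mul_pow]
      rw [mul_pow] at hz
      linear_combination -hz
  choose φ hφd hφ using hφ
  have hq : ∀ a, ∃ q : ℂ → ℂ, Differentiable ℂ q ∧ ∀ z, ‖z‖ ≤ 1 / 2 → ‖φ a z - q z‖ ≤ ε a :=
    fun a => exists_entire_approx ((hφd a).mono fun z hz h => by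
      rw [mem_singleton_iff.1 h] at hz; simp at hz) (hε0 a)
  choose q hqd hq using hq
  set t : A → ℂ → ℂ := fun a z => φ a (w a z) - q a (w a z) with ht
  have hqa : ∀ a ∈ A, ∀ c ∈ U, AnalyticAt ℂ (fun z => q a (w a z)) c := fun a ha c hc =>
    ((hqd a).comp_differentiableOn (hwd a ha)).analyticAt (hU.mem_nhds hc)
  have hta : ∀ a : A, ∀ c ∈ U, c ≠ a → AnalyticAt ℂ (t a) c := by
    intro a c hc hca
    refine AnalyticAt.sub ?_ (hqa a a.2 c hc)
    refine AnalyticAt.fun_comp (f := w a) ?_ ((hwd a a.2).analyticAt (hU.mem_nhds hc))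
    refine (hφd a).analyticAt (isOpen_compl_singleton.mem_nhds fun h1 => ?_)
    have : (c - a) * v a c = 0 := by
      have : 1 - (c - a) * v a c = 1 := h1
      linear_combination -this
    exact (mul_ne_zero (sub_ne_zero.2 hca) ((hv a a.2).2 c hc)) this
  refine ⟨fun z => ∑' a, t a z, fun c hc => ?_⟩
  obtain ⟨B, hBU, hB, hcB, S, hcS, hS⟩ := exists_ball_finset hU hvK hc
  obtain ⟨T, hT, hTs⟩ := exists_differentiableOn_hasSum (t := t) hB
    (fun a => (hε0 a).le) hεs.summable S (fun a ha => ⟨fun z hz =>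
      (hta a z (hBU hz) fun h => by
        have := hS a ha z hz
        rw [h] at this
        norm_num at this).differentiableAt.differentiableWithinAt,
      fun z hz => hq a _ (hS a ha z hz)⟩)
  have hTa := hT.analyticAt (hB.mem_nhds hcB)
  have hsum : ∀ z ∈ B, ∑' a, t a z = (∑ a ∈ S, t a z) + T z := by
    intro z hz
    have h1 : HasSum (fun a => if a ∈ S then t a z else 0) (∑ a ∈ S, t a z) := by
      have := hasSum_sum_of_ne_finset_zero (f := fun a => if a ∈ S then t a z else 0) (s := S)
        (L := .unconditional _) (fun a ha => by simp [ha])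
      rwa [Finset.sum_congr rfl fun a ha => if_pos ha] at this
    refine HasSum.tsum_eq ?_
    convert h1.add (hTs z hz) using 2 with a
    by_cases ha : a ∈ S <;> simp [ha]
  have hMeq : (fun z => ∑' a, t a z) =ᶠ[𝓝[≠] c] fun z => (∑ a ∈ S, t a z) + T z :=
    nhdsWithin_le_nhds (Filter.eventually_of_mem (hB.mem_nhds hcB) hsum)
  by_cases hcA : c ∈ A
  · obtain ⟨r, hr, hrφ⟩ := hφ c hcA
    refine ⟨fun z => r z - q c (w c z) + (∑ a ∈ S.erase ⟨c, hcA⟩, t a z) + T z, ?_, fun _ => ?_,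
      fun h => absurd hcA h⟩
    · refine ((hr.sub (hqa c hcA c hc)).add ?_).add hTa
      refine Finset.analyticAt_fun_sum _ fun a ha => hta a c hc fun h => ?_
      exact (Finset.mem_erase.1 ha).1 (Subtype.ext h.symm)
    · filter_upwards [hMeq, hrφ] with z h1 h2
      rw [h1, ← Finset.add_sum_erase S _ (hcS hcA)]
      simp only [ht, h2]
      ring
  · refine ⟨fun z => (∑ a ∈ S, t a z) + T z, ?_, fun h => absurd h hcA, fun _ => hMeq⟩
    refine AnalyticAt.add ?_ hTa
    refine Finset.analyticAt_fun_sum _ fun a ha => hta a c hc fun h => ?_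
    exact hcA (h ▸ a.2)

/-! ### Bézout relations between holomorphic functions -/

theorem eventually_ne_zero_of_isPreconnected {U : Set ℂ} (hU : IsOpen U) (hUc : IsPreconnected U)
    {a : ℂ → ℂ} (ha : DifferentiableOn ℂ a U) (hne : ∃ z ∈ U, a z ≠ 0) {c : ℂ} (hc : c ∈ U) :
    ∀ᶠ z in 𝓝[≠] c, a z ≠ 0 := by
  refine ((ha.analyticAt (hU.mem_nhds hc)).eventually_eq_zero_or_eventually_ne_zero).resolve_left
    fun h => ?_
  obtain ⟨z, hz, hz0⟩ := hne
  exact hz0 ((ha.analyticOnNhd hU).eqOn_zero_of_preconnected_of_eventuallyEq_zero hUc hc h hz)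

theorem locallyFiniteIn_of_eventually_ne {U : Set ℂ} {p : ℂ → Prop}
    (h : ∀ c ∈ U, ∀ᶠ z in 𝓝[≠] c, ¬ p z) : LocallyFiniteIn {c | c ∈ U ∧ p c} U := by
  intro c hc
  refine ⟨_, eventually_nhdsWithin_iff.1 (h c hc), (finite_singleton c).subset ?_⟩
  rintro z ⟨hz, hz'⟩
  by_contra hzc
  exact hz' hzc hz.2

theorem eqOn_of_punctured {U : Set ℂ} (hU : IsOpen U) {F G : ℂ → ℂ} (hF : DifferentiableOn ℂ F U)
    (hG : DifferentiableOn ℂ G U) (h : ∀ c ∈ U, F =ᶠ[𝓝[≠] c] G) : EqOn F G U := fun c hc =>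
  (((hF.continuousOn.continuousAt (hU.mem_nhds hc)).eventuallyEq_nhds_iff_eventuallyEq_nhdsNE
    (hG.continuousOn.continuousAt (hU.mem_nhds hc))).1 (h c hc)).eq_of_nhds

/-- Two holomorphic functions without common zeros generate the unit ideal. -/
theorem exists_bezout_of_no_common_zeros {U : Set ℂ} (hU : IsOpen U) {a b : ℂ → ℂ}
    (ha : DifferentiableOn ℂ a U) (hb : DifferentiableOn ℂ b U)
    (hb0 : ∀ c ∈ U, ∀ᶠ z in 𝓝[≠] c, b z ≠ 0) (hab : ∀ c ∈ U, b c = 0 → a c ≠ 0) :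
    ∃ x y : ℂ → ℂ, DifferentiableOn ℂ x U ∧ DifferentiableOn ℂ y U ∧
      ∀ z ∈ U, x z * a z + y z * b z = 1 := by
  have haa : ∀ c ∈ U, AnalyticAt ℂ a c := fun c hc => ha.analyticAt (hU.mem_nhds hc)
  have hba : ∀ c ∈ U, AnalyticAt ℂ b c := fun c hc => hb.analyticAt (hU.mem_nhds hc)
  -- With `M = 1 / (a * b) + r` near each zero of `b`, the functions `x = M * b` and `y = 1 / b - M
  -- * a` formally solve the equation. There they equal `1 / a + r * b` and `-(r * a)`, so their
  -- singularities are removable.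
  obtain ⟨M, hM⟩ := exists_prescribed_principal_parts hU (A := {c | c ∈ U ∧ b c = 0})
    (fun c hc => hc.1) (locallyFiniteIn_of_eventually_ne hb0) (h := fun _ z => (a z * b z)⁻¹)
    (fun c hc => ((haa c hc.1).mul (hba c hc.1)).meromorphicAt.inv)
  choose! r hr hr1 hr2 using hM
  obtain ⟨x, hx, hxM⟩ := exists_differentiableOn_of_punctured (X := fun z => M z * b z) hU <| by
    intro c hc
    by_cases h : b c = 0
    · refine ⟨fun z => (a z)⁻¹ + r c z * b z,
        ((haa c hc).inv (hab c hc h)).add ((hr c hc).mul (hba c hc)), ?_⟩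
      filter_upwards [hr1 c hc ⟨hc, h⟩, hb0 c hc] with z h1 h2
      rw [h1, mul_inv]
      field_simp
    · refine ⟨fun z => r c z * b z, (hr c hc).mul (hba c hc), ?_⟩
      filter_upwards [hr2 c hc fun h' => h h'.2] with z h1
      rw [h1]
  obtain ⟨y, hy, hyM⟩ := exists_differentiableOn_of_punctured
      (X := fun z => (b z)⁻¹ - M z * a z) hU <| by
    intro c hc
    by_cases h : b c = 0
    · refine ⟨fun z => - (r c z * a z), ((hr c hc).mul (haa c hc)).neg, ?_⟩
      filter_upwards [hr1 c hc ⟨hc, h⟩, hb0 c hc, nhdsWithin_le_nhds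
        ((haa c hc).continuousAt.eventually_ne (hab c hc h))] with z h1 h2 h3
      rw [h1, mul_inv]
      field_simp
      ring
    · refine ⟨fun z => (b z)⁻¹ - r c z * a z,
        ((hba c hc).inv h).sub ((hr c hc).mul (haa c hc)), ?_⟩
      filter_upwards [hr2 c hc fun h' => h h'.2] with z h1
      rw [h1]
  refine ⟨x, y, hx, hy, eqOn_of_punctured hU ((hx.mul ha).add (hy.mul hb))
    (differentiableOn_const 1) fun c hc => ?_⟩
  filter_upwards [hxM c hc, hyM c hc, hb0 c hc] with z h1 h2 h3
  rw [h1, h2]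
  field_simp
  ring

/-- Two holomorphic functions on a connected open set have a greatest common divisor which is a
combination of them. -/
theorem exists_bezout {U : Set ℂ} (hU : IsOpen U) (hUc : IsPreconnected U) {a b : ℂ → ℂ}
    (ha : DifferentiableOn ℂ a U) (hb : DifferentiableOn ℂ b U) :
    ∃ d a' b' x y : ℂ → ℂ, DifferentiableOn ℂ d U ∧ DifferentiableOn ℂ a' U ∧
      DifferentiableOn ℂ b' U ∧ DifferentiableOn ℂ x U ∧ DifferentiableOn ℂ y U ∧
      ∀ z ∈ U, a z = d z * a' z ∧ b z = d z * b' z ∧ x z * a' z + y z * b' z = 1 := by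
  have hc0 : DifferentiableOn ℂ (fun _ => (0 : ℂ)) U := differentiableOn_const _
  have hc1 : DifferentiableOn ℂ (fun _ => (1 : ℂ)) U := differentiableOn_const _
  by_cases ha0 : ∃ z ∈ U, a z ≠ 0
  swap
  · push Not at ha0
    exact ⟨b, fun _ => 0, fun _ => 1, fun _ => 0, fun _ => 1, hb, hc0, hc1, hc0, hc1,
      fun z hz => by simp [ha0 z hz]⟩
  by_cases hb0 : ∃ z ∈ U, b z ≠ 0
  swap
  · push Not at hb0
    exact ⟨a, fun _ => 1, fun _ => 0, fun _ => 1, fun _ => 0, ha, hc1, hc0, hc1, hc0,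
      fun z hz => by simp [hb0 z hz]⟩
  have hane := fun c hc => eventually_ne_zero_of_isPreconnected hU hUc ha ha0 (c := c) hc
  have hbne := fun c hc => eventually_ne_zero_of_isPreconnected hU hUc hb hb0 (c := c) hc
  have fact : ∀ f : ℂ → ℂ, DifferentiableOn ℂ f U → (∀ c ∈ U, ∀ᶠ z in 𝓝[≠] c, f z ≠ 0) →
      ∀ c ∈ U, ∃ (n : ℕ) (g : ℂ → ℂ), AnalyticAt ℂ g c ∧ g c ≠ 0 ∧
        ∀ᶠ z in 𝓝 c, f z = (z - c) ^ n * g z := fun f hf hne c hc => by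
    refine (hf.analyticAt (hU.mem_nhds hc)).exists_eventuallyEq_pow_smul_nonzero_iff.2 fun h => ?_
    obtain ⟨z, h1, h2⟩ := ((h.filter_mono nhdsWithin_le_nhds).and (hne c hc)).exists
    exact h2 h1
  choose! m g hg hg0 hga using fact a ha hane
  choose! n k hk hk0 hkb using fact b hb hbne
  have hmin : LocallyFiniteIn {c | c ∈ U ∧ min (m c) (n c) ≠ 0} U := by
    refine locallyFiniteIn_of_eventually_ne fun c hc => ?_
    filter_upwards [hane c hc, nhdsWithin_le_nhds (hU.mem_nhds hc)] with z hz hzU hne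
    have hm : m z ≠ 0 := fun h => hne (by simp [h])
    have := (hga z hzU).self_of_nhds
    rw [sub_self, zero_pow hm, zero_mul] at this
    exact hz this
  obtain ⟨d, hd⟩ := exists_prescribed_zeros hU (fun c => min (m c) (n c)) hmin
  choose! e he he0 hde using hd
  have hdd : DifferentiableOn ℂ d U := fun c hc => by
    have h1 := he c hc
    have : AnalyticAt ℂ (fun z => (z - c) ^ min (m c) (n c) * e c z) c := by fun_prop
    exact (this.congr (hde c hc).symm).differentiableAt.differentiableWithinAt
  have hdne : ∀ c ∈ U, ∀ᶠ z in 𝓝[≠] c, d z ≠ 0 := fun c hc => by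
    filter_upwards [nhdsWithin_le_nhds (hde c hc), self_mem_nhdsWithin, nhdsWithin_le_nhds
      ((he c hc).continuousAt.eventually_ne (he0 c hc))] with z h1 h2 h3
    rw [h1]
    exact mul_ne_zero (pow_ne_zero _ (sub_ne_zero.2 h2)) h3
  have quot : ∀ (f : ℂ → ℂ) (p : ℂ → ℕ) (h : ℂ → ℂ → ℂ), DifferentiableOn ℂ f U →
      (∀ c ∈ U, AnalyticAt ℂ (h c) c) →
      (∀ c ∈ U, ∀ᶠ z in 𝓝 c, f z = (z - c) ^ p c * h c z) → (∀ c, min (m c) (n c) ≤ p c) →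
      ∃ f' : ℂ → ℂ, DifferentiableOn ℂ f' U ∧ (∀ z ∈ U, f z = d z * f' z) ∧
        ∀ c ∈ U, h c c ≠ 0 → p c = min (m c) (n c) → f' c ≠ 0 := by
    intro f p h hf hh hfh hp
    have loc : ∀ c ∈ U, (fun z => f z / d z) =ᶠ[𝓝[≠] c]
        fun z => (z - c) ^ (p c - min (m c) (n c)) * (h c z / e c z) := fun c hc => by
      filter_upwards [nhdsWithin_le_nhds (hde c hc), nhdsWithin_le_nhds (hfh c hc),
        self_mem_nhdsWithin, nhdsWithin_le_nhds
        ((he c hc).continuousAt.eventually_ne (he0 c hc))] with z h1 h2 h3 h4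
      have h5 : z - c ≠ 0 := sub_ne_zero.2 h3
      rw [h1, h2, pow_sub₀ _ h5 (hp c)]
      field_simp
    have han : ∀ c ∈ U, AnalyticAt ℂ
        (fun z => (z - c) ^ (p c - min (m c) (n c)) * (h c z / e c z)) c := fun c hc =>
      AnalyticAt.mul (by fun_prop) ((hh c hc).div (he c hc) (he0 c hc))
    obtain ⟨f', hf', hff'⟩ := exists_differentiableOn_of_punctured hU
      fun c hc => ⟨_, han c hc, loc c hc⟩
    refine ⟨f', hf', eqOn_of_punctured hU hf (hdd.mul hf') fun c hc => ?_, fun c hc hne hpc => ?_⟩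
    · filter_upwards [hff' c hc, hdne c hc] with z h1 h2
      rw [h1]
      field_simp
    · have : f' =ᶠ[𝓝 c] fun z => (z - c) ^ (p c - min (m c) (n c)) * (h c z / e c z) :=
        ((hf'.continuousOn.continuousAt
          (hU.mem_nhds hc)).eventuallyEq_nhds_iff_eventuallyEq_nhdsNE
          (han c hc).continuousAt).1 ((hff' c hc).trans (loc c hc))
      rw [this.eq_of_nhds, hpc]
      simpa using ⟨hne, he0 c hc⟩
  obtain ⟨a', ha', haa', ha'0⟩ := quot a m g ha hg hga fun c => min_le_left _ _
  obtain ⟨b', hb', hbb', hb'0⟩ := quot b n k hb hk hkb fun c => min_le_right _ _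
  obtain ⟨x, y, hx, hy, hxy⟩ := exists_bezout_of_no_common_zeros hU ha' hb'
    (fun c hc => by
      filter_upwards [hbne c hc, nhdsWithin_le_nhds (hU.mem_nhds hc)] with z hz hzU h0
      rw [hbb' z hzU, h0, mul_zero] at hz
      exact hz rfl)
    -- At a zero of `b'` the order of `b` exceeds the minimum, so the minimum is the order of `a`
    -- and `a'` does not vanish.
    (fun c hc h0 => ha'0 c hc (hg0 c hc) (by
      have : n c ≠ min (m c) (n c) := fun h => hb'0 c hc (hk0 c hc) h h0
      omega))
  exact ⟨d, a', b', x, y, hdd, ha', hb', hx, hy, fun z hz => ⟨haa' z hz, hbb' z hz, hxy z hz⟩⟩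

/-! ### Triangular reduction over a Hermite ring -/

section Hermite

variable {R ι : Type*} [CommRing R]

/-- The linear map that acts on the coordinates `p` and `i` by the matrix `!![x, y; s, t]`. -/
def pairMap [DecidableEq ι] (p i : ι) (x y s t : R) : (ι → R) →ₗ[R] (ι → R) where
  toFun u j := if j = p then x * u p + y * u i else if j = i then s * u p + t * u i else u j
  map_add' u w := by
    ext j
    simp only [Pi.add_apply]
    split_ifs <;> ring
  map_smul' c u := by
    ext j
    simp only [Pi.smul_apply, smul_eq_mul, RingHom.id_apply]
    split_ifs <;> ring

theorem pairMap_comp_eq_id [DecidableEq ι] {p i : ι} (hpi : p ≠ i) {x y s t x' y' s' t' : R}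
    (h1 : x * x' + y * s' = 1) (h2 : x * y' + y * t' = 0) (h3 : s * x' + t * s' = 0)
    (h4 : s * y' + t * t' = 1) :
    pairMap p i x y s t ∘ₗ pairMap p i x' y' s' t' = LinearMap.id := by
  refine LinearMap.ext fun u => funext fun k => ?_
  simp only [pairMap, LinearMap.comp_apply, LinearMap.coe_mk, AddHom.coe_mk, LinearMap.id_apply,
    if_true, hpi.symm, if_false]
  split_ifs with hp hi
  · subst hp
    linear_combination u k * h1 + u i * h2
  · subst hi
    linear_combination u p * h3 + u k * h4
  · rfl

/-- The matrix `!![x, y; -b, a]` has determinant `x * a + y * b = 1` and sends `(d * a, d * b)` to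
`(d, 0)`. -/
theorem exists_linearEquiv_apply_eq_zero [DecidableEq ι]
    (H : ∀ a b : R, ∃ d a' b' x y, a = d * a' ∧ b = d * b' ∧ x * a' + y * b' = 1)
    {p i : ι} (hpi : p ≠ i) (v : ι → R) :
    ∃ P : (ι → R) ≃ₗ[R] (ι → R), P v i = 0 ∧ (∀ u j, j ≠ p → j ≠ i → P u j = u j) ∧
      ∀ u, u p = 0 → u i = 0 → P u = u := by
  obtain ⟨d, a, b, x, y, ha, hb, hxy⟩ := H (v p) (v i)
  refine ⟨LinearEquiv.ofLinearMap (pairMap p i x y (-b) a) (pairMap p i a (-y) b x)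
    (pairMap_comp_eq_id hpi hxy (by ring) (by ring) (by linear_combination hxy))
    (pairMap_comp_eq_id hpi (by linear_combination hxy) (by ring) (by ring)
      (by linear_combination hxy)), ?_, ?_, ?_⟩
  · simp only [LinearEquiv.coe_ofLinearMap, pairMap, LinearMap.coe_mk, AddHom.coe_mk, hpi.symm,
      if_false, if_true, ha, hb]
    ring
  · intro u j hp hi
    simp [pairMap, hp, hi]
  · intro u hp hi
    funext j
    simp only [LinearEquiv.coe_ofLinearMap, pairMap, LinearMap.coe_mk, AddHom.coe_mk, hp, hi]
    split_ifs with h1 h2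
    · rw [h1, hp]; ring
    · rw [h2, hi]; ring
    · rfl

/-- Coordinates are cleared one at a time against the pivot `p`. The second clause protects vectors
that are already reduced. -/
theorem exists_linearEquiv_forall_apply_eq_zero [DecidableEq ι]
    (H : ∀ a b : R, ∃ d a' b' x y, a = d * a' ∧ b = d * b' ∧ x * a' + y * b' = 1)
    {p : ι} (v : ι → R) (S : Finset ι) : p ∉ S →
    ∃ P : (ι → R) ≃ₗ[R] (ι → R), (∀ i ∈ S, P v i = 0) ∧
      ∀ u, u p = 0 → (∀ i ∈ S, u i = 0) → P u = u := by
  induction S using Finset.induction_on with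
  | empty => exact fun _ => ⟨LinearEquiv.refl R _, by simp, by simp⟩
  | insert i S hi ih =>
    intro hp
    rw [Finset.mem_insert, not_or] at hp
    obtain ⟨P, hP, hP'⟩ := ih hp.2
    obtain ⟨Q, hQ, hQ', hQ''⟩ := exists_linearEquiv_apply_eq_zero H hp.1 (P v)
    refine ⟨P.trans Q, fun j hj => ?_, fun u hup hu => ?_⟩
    · rw [LinearEquiv.trans_apply]
      rcases Finset.mem_insert.1 hj with rfl | hj
      · exact hQ
      · rw [hQ' _ _ (fun h => hp.2 (h ▸ hj)) fun h => hi (h ▸ hj)]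
        exact hP j hj
    · rw [LinearEquiv.trans_apply, hP' u hup fun j hj => hu j (Finset.mem_insert_of_mem hj)]
      exact hQ'' u hup (hu i (Finset.mem_insert_self _ _))

/-- Triangular form of a matrix over a Hermite ring. -/
theorem exists_linearEquiv_triangular
    (H : ∀ a b : R, ∃ d a' b' x y, a = d * a' ∧ b = d * b' ∧ x * a' + y * b' = 1)
    {n l : ℕ} (hl : l ≤ n) (v : Fin l → Fin n → R) :
    ∃ P : (Fin n → R) ≃ₗ[R] (Fin n → R), ∀ (j : Fin l) (i : Fin n), (j : ℕ) < i →
      P (v j) i = 0 := by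
  induction l with
  | zero => exact ⟨LinearEquiv.refl R _, fun j => j.elim0⟩
  | succ l ih =>
    obtain ⟨P, hP⟩ := ih (by omega) fun j => v j.castSucc
    -- The pivot is the coordinate with index `l`. The earlier vectors vanish there and beyond, so
    -- `Q` fixes them.
    obtain ⟨Q, hQ, hQ'⟩ := exists_linearEquiv_forall_apply_eq_zero H (p := ⟨l, hl⟩)
      (P (v (Fin.last l))) (Finset.univ.filter fun i : Fin n => l < i) (by simp)
    refine ⟨P.trans Q, fun j => ?_⟩
    refine Fin.lastCases (fun i hi => ?_) (fun j i hi => ?_) j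
    · exact hQ i (by simpa using hi)
    · rw [LinearEquiv.trans_apply, hQ' _ (hP j _ j.2)]
      · exact hP j i hi
      · intro i hi
        exact hP j i (j.2.trans (by simpa using hi))

/-- Base change of a linear automorphism of a free module along a ring homomorphism. -/
theorem exists_linearEquiv_map {S : Type*} [CommRing S] [Fintype ι] [DecidableEq ι] (φ : R →+* S)
    (P : (ι → R) ≃ₗ[R] (ι → R)) :
    ∃ Q : (ι → S) ≃ₗ[S] (ι → S), ∀ u, Q (φ ∘ u) = φ ∘ P u := by
  have hcomp : ∀ A B : (ι → R) →ₗ[R] (ι → R), A ∘ₗ B = LinearMap.id →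
      Matrix.toLin' ((LinearMap.toMatrix' A).map φ) ∘ₗ
        Matrix.toLin' ((LinearMap.toMatrix' B).map φ) = LinearMap.id := by
    intro A B h
    rw [← Matrix.toLin'_mul, ← Matrix.map_mul, ← LinearMap.toMatrix'_comp, h,
      LinearMap.toMatrix'_id, Matrix.map_one _ φ.map_zero φ.map_one, Matrix.toLin'_one]
  refine ⟨LinearEquiv.ofLinearMap _ _ (hcomp P P.symm (by ext; simp)) (hcomp P.symm P (by ext; simp)),
    fun u => ?_⟩
  funext i
  rw [LinearEquiv.coe_ofLinearMap, Matrix.toLin'_apply, Function.comp_apply]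
  have := RingHom.map_mulVec φ (LinearMap.toMatrix' (P : (ι → R) →ₗ[R] (ι → R))) u i
  rw [← this, LinearMap.toMatrix'_mulVec]
  rfl

end Hermite

/-! ### Holomorphic functions as a Hermite ring -/

/-- The ring of functions on the plane that are holomorphic on `U`. -/
def holomorphicSubring (U : Set ℂ) : Subring (ℂ → ℂ) where
  carrier := {f | DifferentiableOn ℂ f U}
  mul_mem' := fun {_ _} hf hg => DifferentiableOn.mul hf hg
  one_mem' := differentiableOn_const 1
  add_mem' := fun {_ _} hf hg => DifferentiableOn.add hf hg
  zero_mem' := differentiableOn_const 0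
  neg_mem' := fun {_} hf => DifferentiableOn.neg hf

theorem holomorphicSubring_bezout {U : Set ℂ} (hU : IsOpen U) (hUc : IsPreconnected U)
    (a b : holomorphicSubring U) :
    ∃ d a' b' x y, a = d * a' ∧ b = d * b' ∧ x * a' + y * b' = 1 := by
  classical
  obtain ⟨d, a', b', x, y, hd, ha', hb', hx, hy, h⟩ := exists_bezout hU hUc a.2 b.2
  -- Elements of the ring are arbitrary off `U`, yet the identities must hold at every point of the
  -- plane. Off `U` they are solved pointwise in the field `ℂ`.
  have hext : ∀ z, ∃ p : Fin 5 → ℂ, a.1 z = p 0 * p 1 ∧ b.1 z = p 0 * p 2 ∧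
      p 3 * p 1 + p 4 * p 2 = 1 := by
    intro z
    by_cases hz : a.1 z = 0
    · exact ⟨![b.1 z, 0, 1, 0, 1], by simp [hz]⟩
    · refine ⟨![a.1 z, 1, b.1 z / a.1 z, 1, 0], by simp, ?_, by simp⟩
      simp only [Matrix.cons_val]
      field_simp
  choose p hp using hext
  have glue : ∀ {f : ℂ → ℂ} (i : Fin 5), DifferentiableOn ℂ f U →
      U.piecewise f (fun z => p z i) ∈ holomorphicSubring U := fun {f} i hf =>
    DifferentiableOn.congr hf fun z hz => Set.piecewise_eq_of_mem _ _ _ hz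
  refine ⟨⟨_, glue 0 hd⟩, ⟨_, glue 1 ha'⟩, ⟨_, glue 2 hb'⟩, ⟨_, glue 3 hx⟩, ⟨_, glue 4 hy⟩,
    Subtype.ext (funext fun z => ?_), Subtype.ext (funext fun z => ?_),
    Subtype.ext (funext fun z => ?_)⟩
  all_goals
    by_cases hz : z ∈ U
    · simp [Set.piecewise, hz, ← h z hz]
    · simp [Set.piecewise, hz, ← hp z]

/-! ### Trivializations, rank and frames -/

namespace VectorValued

variable {V : Type*} [AddCommGroup V] [Module ℂ V]

/-- A holomorphic trivialization of the trivial bundle `U × V` that takes the given sections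
into the span of the first `l` coordinate vectors. -/
theorem exists_adapted_trivialization [FiniteDimensional ℂ V]
    {U : Set ℂ} (hU : IsOpen U) (hUc : IsPreconnected U) {l : ℕ}
    (hl : l ≤ Module.finrank ℂ V) {g : Fin l → ℂ → V} (hg : ∀ j, IsHolomorphicOn (g j) U) :
    ∃ E : ℂ → V ≃ₗ[ℂ] (Fin (Module.finrank ℂ V) → ℂ),
      (∀ h : ℂ → V, IsHolomorphicOn h U → ∀ i, DifferentiableOn ℂ (fun z => E z (h z) i) U) ∧
      (∀ u : Fin (Module.finrank ℂ V) → ℂ, IsHolomorphicOn (fun z => (E z).symm u) U) ∧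
      ∀ z j (i : Fin (Module.finrank ℂ V)), l ≤ (i : ℕ) → E z (g j z) i = 0 := by
  set b := Module.finBasis ℂ V
  let vec : ∀ h : ℂ → V, IsHolomorphicOn h U → Fin (Module.finrank ℂ V) → holomorphicSubring U :=
    fun h hh i => ⟨fun z => b.equivFun (h z) i, by
      have := hh (b.coord i)
      exact this⟩
  obtain ⟨P, hP⟩ := exists_linearEquiv_triangular (holomorphicSubring_bezout hU hUc) hl
    fun j => vec (g j) (hg j)
  let ev : ℂ → holomorphicSubring U →+* ℂ := fun z =>
    (Pi.evalRingHom (fun _ : ℂ => ℂ) z).comp (holomorphicSubring U).subtype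
  have hev : ∀ z (a : holomorphicSubring U), ev z a = a.1 z := fun z a => rfl
  choose Q hQ using fun z => exists_linearEquiv_map (ev z) P
  have hvec : ∀ h hh z, b.equivFun (h z) = ev z ∘ vec h hh := fun h hh z => rfl
  refine ⟨fun z => b.equivFun.trans (Q z), fun h hh i => ?_, fun u w => ?_, fun z j i hi => ?_⟩
  · simp only [LinearEquiv.trans_apply, hvec h hh, hQ]
    exact (P (vec h hh) i).2
  · let u' : Fin (Module.finrank ℂ V) → holomorphicSubring U :=
      fun i => ⟨fun _ => u i, differentiableOn_const _⟩
    -- The inverse of `Q z` is the value at `z` of the inverse of `P`, so the inverse trivialization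
    -- is holomorphic because `P` is invertible over the ring.
    have hu : ∀ z, (Q z).symm u = ev z ∘ P.symm u' := fun z => by
      rw [LinearEquiv.symm_apply_eq, hQ, LinearEquiv.apply_symm_apply]
      rfl
    simp only [LinearEquiv.trans_symm, LinearEquiv.trans_apply, hu,
      Module.Basis.equivFun_symm_apply, map_sum, map_smul, smul_eq_mul, Function.comp_apply, hev]
    refine DifferentiableOn.fun_sum fun i _ => DifferentiableOn.mul_const ?_ _
    exact (P.symm u' i).2
  · rw [LinearEquiv.trans_apply, hvec _ (hg j), hQ, Function.comp_apply,
      hP j i (j.2.trans_le hi), map_zero]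

/-- If a holomorphic section is in the span of sections with vanishing last coordinates near one
point, then its last coordinates vanish. -/
theorem coordinates_eq_zero {U : Set ℂ} (hU : IsOpen U) (hUc : IsPreconnected U) {l n : ℕ}
    {g : Fin l → ℂ → V} {E : ℂ → V ≃ₗ[ℂ] (Fin n → ℂ)}
    (hE : ∀ h : ℂ → V, IsHolomorphicOn h U → ∀ i, DifferentiableOn ℂ (fun z => E z (h z) i) U)
    (hEg : ∀ z j (i : Fin n), l ≤ (i : ℕ) → E z (g j z) i = 0) {h : ℂ → V} (hh : IsHolomorphicOn h U)
    {c : ℂ} (hc : c ∈ U) (hspan : ∀ᶠ z in 𝓝 c, h z ∈ Submodule.span ℂ (Set.range fun j => g j z))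
    {z : ℂ} (hz : z ∈ U) {i : Fin n} (hi : l ≤ (i : ℕ)) : E z (h z) i = 0 := by
  refine ((hE h hh i).analyticOnNhd hU).eqOn_zero_of_preconnected_of_eventuallyEq_zero hUc hc ?_ hz
  filter_upwards [hspan] with z hz
  have : Submodule.span ℂ (Set.range fun j => g j z) ≤
      LinearMap.ker (LinearMap.proj i ∘ₗ (E z : V →ₗ[ℂ] (Fin n → ℂ))) := by
    rw [Submodule.span_le]
    rintro _ ⟨j, rfl⟩
    exact hEg z j i hi
  exact this hz

theorem rankAt_le {k : ℕ} (f : Fin k → ℂ → V) (z : ℂ) : rankAt f z ≤ k := by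
  exact (finrank_range_le_card (R := ℂ) fun α => f α z).trans_eq (Fintype.card_fin k)

theorem rankAt_le_rankOn {k : ℕ} (f : Fin k → ℂ → V) {U : Set ℂ} {z : ℂ} (hz : z ∈ U) :
    rankAt f z ≤ rankOn f U :=
  le_ciSup (f := fun c : U => rankAt f c) ⟨k, by rintro _ ⟨c, rfl⟩; exact rankAt_le f c⟩ ⟨z, hz⟩

theorem rankAt_eq_iff_linearIndependent {l : ℕ} {g : Fin l → ℂ → V} {z : ℂ} :
    rankAt g z = l ↔ LinearIndependent ℂ fun β => g β z := by
  rw [linearIndependent_iff_card_eq_finrank_span, Fintype.card_fin]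
  exact eq_comm

theorem isHolomorphicFrameOn_iff {l : ℕ} {g : Fin l → ℂ → V} {U : Set ℂ} (hU : U.Nonempty) :
    IsHolomorphicFrameOn g U ↔
      (∀ β, IsHolomorphicOn (g β) U) ∧ ∀ z ∈ U, LinearIndependent ℂ fun β => g β z := by
  refine and_congr_right fun _ => ⟨fun h z hz => ?_, fun h => ?_⟩
  · rw [← rankAt_eq_iff_linearIndependent, h.1 z hz, h.2]
  · have hr : rankOn g U = l := by
      have := hU.to_subtype
      have h' : ∀ c : U, rankAt g c = l := fun c => rankAt_eq_iff_linearIndependent.2 (h c c.2)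
      simp only [rankOn, h', ciSup_const]
    exact ⟨fun z hz => (rankAt_eq_iff_linearIndependent.2 (h z hz)).trans hr.symm, hr⟩

/-- Linear independence of holomorphic families is an open condition. -/
theorem eventually_linearIndependent [FiniteDimensional ℂ V]
    {U : Set ℂ} (hU : IsOpen U) {l : ℕ}
    {g : Fin l → ℂ → V} (hg : ∀ j, IsHolomorphicOn (g j) U) {c : ℂ} (hc : c ∈ U)
    (hli : LinearIndependent ℂ fun j => g j c) :
    ∀ᶠ z in 𝓝 c, LinearIndependent ℂ fun j => g j z := by
  set b := Module.finBasis ℂ V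
  have hcont : ContinuousAt (fun z j => b.equivFun (g j z)) c := by
    refine continuousAt_pi.2 fun j => continuousAt_pi.2 fun i => ?_
    exact (hg j (b.coord i)).continuousOn.continuousAt (hU.mem_nhds hc)
  have hli' : LinearIndependent ℂ fun j => b.equivFun (g j c) :=
    hli.map' b.equivFun.toLinearMap (LinearEquiv.ker _)
  filter_upwards [hcont.eventually (isOpen_setOfPred_linearIndependent.mem_nhds hli')] with z hz
  exact LinearIndependent.of_comp b.equivFun.toLinearMap hz

/-- Around a suitable point of `U` a family of rank `l` contains a subfamily of `l` functions with
independent values. -/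
theorem exists_independent_subfamily [FiniteDimensional ℂ V]
    {U : Set ℂ} (hU : IsOpen U) (hUne : U.Nonempty) {k l : ℕ}
    {f : Fin k → ℂ → V} (hf : ∀ α, IsHolomorphicOn (f α) U) (hl : rankOn f U = l) :
    ∃ c ∈ U, ∃ s : Fin l → Fin k,
      ∀ᶠ z in 𝓝 c, z ∈ U ∧ (LinearIndependent ℂ fun j => f (s j) z) ∧
        Submodule.span ℂ (Set.range fun j => f (s j) z) =
          Submodule.span ℂ (Set.range fun α => f α z) ∧ rankAt f z = l := by
  have := hUne.to_subtype
  obtain ⟨c, hc⟩ : ∃ c : U, rankAt f c = l := by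
    rw [← hl]
    exact Nat.sSup_mem (Set.range_nonempty fun c : U => rankAt f c)
      ⟨k, by rintro _ ⟨c, rfl⟩; exact rankAt_le f c⟩
  obtain ⟨κ, a, ha, hspan, hli⟩ := exists_linearIndependent' ℂ fun α => f α c
  have : Finite κ := Finite.of_injective a ha
  have := Fintype.ofFinite κ
  have hcard : Fintype.card κ = l := by
    rw [linearIndependent_iff_card_eq_finrank_span.1 hli, Set.finrank, hspan]
    exact hc
  let e := (Fintype.equivFinOfCardEq hcard).symm
  refine ⟨c, c.2, a ∘ e, ?_⟩
  filter_upwards [hU.mem_nhds c.2, eventually_linearIndependent hU (g := fun j => f (a (e j)))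
    (fun j => hf _) c.2 (hli.comp e e.injective)] with z hz hli
  have hle : Submodule.span ℂ (Set.range fun j => f (a (e j)) z) ≤
      Submodule.span ℂ (Set.range fun α => f α z) :=
    Submodule.span_mono (Set.range_subset_iff.2 fun j => ⟨a (e j), rfl⟩)
  have h1 : Module.finrank ℂ (Submodule.span ℂ (Set.range fun j => f (a (e j)) z)) = l :=
    rankAt_eq_iff_linearIndependent.2 hli
  have h2 : rankAt f z ≤ l := hl ▸ rankAt_le_rankOn f hz
  -- The rank of `f` never exceeds `l` on `U`, so `l` independent members already span.
  have h3 := Submodule.eq_of_le_of_finrank_le hle (h1.symm ▸ h2)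
  refine ⟨hz, hli, h3, ?_⟩
  rw [rankAt, ← h3, h1]

/-- The frame consists of the first `l` vectors of a trivialization adapted to an independent
subfamily; the coefficients are the coordinates of `f`. The subfamily itself would not do, as it may
become dependent elsewhere in `U`. -/
theorem exists_frame [FiniteDimensional ℂ V]
    {U : Set ℂ} (hU : IsOpen U) (hUc : IsConnected U) {k l : ℕ}
    {f : Fin k → ℂ → V} (hf : ∀ α, IsHolomorphicOn (f α) U) (hl : rankOn f U = l) :
    ∃ (g : Fin l → ℂ → V) (d : Fin l → Fin k → ℂ → ℂ),
      IsHolomorphicFrameOn g U ∧ IsHolomorphicRepOn f g d U := by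
  obtain ⟨c, hc, s, hs⟩ := exists_independent_subfamily hU hUc.nonempty hf hl
  have hln : l ≤ Module.finrank ℂ V := by
    simpa using hs.self_of_nhds.2.1.fintype_card_le_finrank
  obtain ⟨E, hE, hE', hEs⟩ := exists_adapted_trivialization hU hUc.isPreconnected hln
    (g := fun j => f (s j)) fun j => hf _
  refine ⟨fun β z => (E z).symm (Pi.single (Fin.castLE hln β) 1),
    fun β α z => E z (f α z) (Fin.castLE hln β), (isHolomorphicFrameOn_iff hUc.nonempty).2
      ⟨fun β => hE' _, fun z hz => ?_⟩, fun β α => hE _ (hf α) _, fun α z hz => ?_⟩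
  · have h1 := (Pi.basisFun ℂ (Fin (Module.finrank ℂ V))).linearIndependent.comp
      (Fin.castLE hln) (Fin.castLE_injective hln)
    have h2 := h1.map' ((E z).symm : _ →ₗ[ℂ] V) (LinearEquiv.ker _)
    simpa [Function.comp_def] using h2
  · have h0 := fun i hi => coordinates_eq_zero hU hUc.isPreconnected hE hEs (hf α) hc
      (by
        filter_upwards [hs] with z hz
        rw [hz.2.2.1]
        exact Submodule.subset_span ⟨α, rfl⟩) hz (i := i) hi
    apply (E z).injective
    simp only [map_sum, map_smul, LinearEquiv.apply_symm_apply]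
    funext i
    simp only [Finset.sum_apply, Pi.smul_apply, smul_eq_mul, Pi.single_apply, mul_ite, mul_one,
      mul_zero]
    by_cases hi : (i : ℕ) < l
    · rw [Finset.sum_eq_single ⟨i, hi⟩]
      · simp
      · intro β _ hβ
        rw [if_neg]
        rintro rfl
        exact hβ rfl
      · simp
    · rw [h0 i (not_lt.1 hi), Finset.sum_eq_zero]
      intro β _
      rw [if_neg]
      rintro rfl
      exact hi β.2

theorem differentiableOn_det {U : Set ℂ} {l : ℕ} {T : ℂ → Matrix (Fin l) (Fin l) ℂ}
    (hT : ∀ i j, DifferentiableOn ℂ (fun z => T z i j) U) :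
    DifferentiableOn ℂ (fun z => (T z).det) U := by
  simp only [Matrix.det_apply]
  refine DifferentiableOn.fun_sum fun σ _ => DifferentiableOn.const_smul ?_ _
  exact DifferentiableOn.fun_finsetProd fun i _ => hT _ _

/-- The span of `f` lies in that of `g`, whose dimension is at most `l`. -/
theorem span_eq_of_rep {U : Set ℂ} {k l : ℕ} {f : Fin k → ℂ → V} {g : Fin l → ℂ → V}
    {d : Fin l → Fin k → ℂ → ℂ} (h : IsHolomorphicRepOn f g d U) {z : ℂ} (hz : z ∈ U)
    (hr : rankAt f z = l) : Submodule.span ℂ (Set.range fun α => f α z) =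
      Submodule.span ℂ (Set.range fun β => g β z) := by
  have := FiniteDimensional.span_of_finite ℂ (Set.finite_range fun β => g β z)
  refine Submodule.eq_of_le_of_finrank_le (Submodule.span_le.2 ?_) ?_
  · rintro _ ⟨α, rfl⟩
    simp only [h.2 α z hz]
    exact Submodule.sum_mem _ fun β _ =>
      Submodule.smul_mem _ _ (Submodule.subset_span ⟨β, rfl⟩)
  · exact (rankAt_le g z).trans hr.ge

/-- In a trivialization adapted to `g`, the first `l` coordinates of `g` form an invertible matrix
`T`, and those of `g'` are the right-hand sides of linear systems solved by Cramer's rule. -/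
theorem exists_change_of_frame [FiniteDimensional ℂ V]
    {U : Set ℂ} (hU : IsOpen U) (hUc : IsPreconnected U) {l : ℕ}
    {g g' : Fin l → ℂ → V} (hg : ∀ β, IsHolomorphicOn (g β) U)
    (hli : ∀ z ∈ U, LinearIndependent ℂ fun β => g β z) (hg' : ∀ β, IsHolomorphicOn (g' β) U)
    {c : ℂ} (hc : c ∈ U) (hspan : ∀ α, ∀ᶠ z in 𝓝 c,
      g' α z ∈ Submodule.span ℂ (Set.range fun β => g β z)) :
    ∃ d : Fin l → Fin l → ℂ → ℂ, IsHolomorphicRepOn g' g d U := by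
  have hln : l ≤ Module.finrank ℂ V := by
    simpa using (hli c hc).fintype_card_le_finrank
  obtain ⟨E, hE, -, hEg⟩ := exists_adapted_trivialization hU hUc hln hg
  let T : ℂ → Matrix (Fin l) (Fin l) ℂ := fun z => Matrix.of fun i j =>
    E z (g j z) (Fin.castLE hln i)
  let r : Fin l → ℂ → Fin l → ℂ := fun α z i => E z (g' α z) (Fin.castLE hln i)
  have key : ∀ z (x : Fin l → ℂ) (v : V), (∀ i : Fin _, l ≤ (i : ℕ) → E z v i = 0) →
      (T z).mulVec x = (fun i => E z v (Fin.castLE hln i)) → v = ∑ j, x j • g j z := by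
    intro z x v hv hx
    apply (E z).injective
    funext i
    simp only [map_sum, map_smul, Finset.sum_apply, Pi.smul_apply, smul_eq_mul]
    by_cases hi : (i : ℕ) < l
    · have := congrFun hx ⟨i, hi⟩
      simp only [Matrix.mulVec, dotProduct, T, Matrix.of_apply, Fin.castLE_mk, Fin.eta] at this
      rw [← this]
      exact Finset.sum_congr rfl fun j _ => mul_comm _ _
    · rw [hv i (not_lt.1 hi), Finset.sum_eq_zero]
      intro j _
      rw [hEg z j i (not_lt.1 hi), mul_zero]
  have hdet : ∀ z ∈ U, (T z).det ≠ 0 := by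
    intro z hz h0
    obtain ⟨x, hx0, hx⟩ := Matrix.exists_mulVec_eq_zero_iff.2 h0
    have h1 := key z x 0 (by simp) (by rw [hx]; funext i; simp)
    exact hx0 (funext (Fintype.linearIndependent_iff.1 (hli z hz) x h1.symm))
  have hTd : ∀ i j, DifferentiableOn ℂ (fun z => T z i j) U := fun i j => hE _ (hg j) _
  refine ⟨fun β α z => (T z).cramer (r α z) β / (T z).det, fun β α => ?_, fun α z hz => ?_⟩
  · refine DifferentiableOn.div ?_ (differentiableOn_det hTd) hdet
    simp only [Matrix.cramer_apply]
    refine differentiableOn_det fun i j => ?_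
    simp only [Matrix.updateCol_apply]
    split_ifs
    · exact hE _ (hg' α) _
    · exact hTd i j
  · refine key z _ _ (fun i hi => coordinates_eq_zero hU hUc hE hEg (hg' α) hc (hspan α) hz hi) ?_
    have h1 : (fun β => (T z).cramer (r α z) β / (T z).det) =
        (T z).det⁻¹ • (T z).cramer (r α z) := by
      funext β
      simp [div_eq_inv_mul]
    rw [h1, Matrix.mulVec_smul, Matrix.mulVec_cramer, smul_smul, inv_mul_cancel₀ (hdet z hz),
      one_smul]

end VectorValued

theorem propositiont {V : Type*} [AddCommGroup V] [Module ℂ V] [FiniteDimensional ℂ V]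
    (U : Set ℂ) (hUo : IsOpen U) (hUc : IsConnected U) (k l : ℕ) (f : Fin k → ℂ → V)
    (hf : ∀ α, VectorValued.IsHolomorphicOn (f α) U)
    (hl : VectorValued.rankOn f U = l) :
    (∃ (g : Fin l → ℂ → V) (d : Fin l → Fin k → ℂ → ℂ),
      VectorValued.IsHolomorphicFrameOn g U ∧ VectorValued.IsHolomorphicRepOn f g d U) ∧
    (∀ (g g' : Fin l → ℂ → V) (d d' : Fin l → Fin k → ℂ → ℂ),
      VectorValued.IsHolomorphicFrameOn g U → VectorValued.IsHolomorphicRepOn f g d U →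
      VectorValued.IsHolomorphicFrameOn g' U → VectorValued.IsHolomorphicRepOn f g' d' U →
      ∃ c : Fin l → Fin l → ℂ → ℂ, VectorValued.IsHolomorphicRepOn g' g c U) := by
  refine ⟨VectorValued.exists_frame hUo hUc hf hl, fun g g' d d' hg hd hg' hd' => ?_⟩
  -- The rank of `f` may drop at some points of `U`, so the spans of `g` and `g'` are compared only
  -- near one point where it is `l`.
  obtain ⟨c, hc, s, hs⟩ := VectorValued.exists_independent_subfamily hUo hUc.nonempty hf hl
  refine VectorValued.exists_change_of_frame hUo hUc.isPreconnected hg.1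
    ((VectorValued.isHolomorphicFrameOn_iff hUc.nonempty).1 hg).2 hg'.1 hc fun α => ?_
  filter_upwards [hs] with z hz
  rw [← VectorValued.span_eq_of_rep hd hz.1 hz.2.2.2, VectorValued.span_eq_of_rep hd' hz.1 hz.2.2.2]
  exact Submodule.subset_span ⟨α, rfl⟩
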